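/- Let $\theta\in[0,2\pi)$ with $\theta\neq 0,\pi$, and put $c=\cos\theta$, $s=\sin\theta$. Consider the 3-state quantum walk on $\mathbb{Z}$ whose state at time $t\in\{0,1,2,\dots\}$ is $|\Psi_t\rangle=\sum_{x\in\mathbb{Z}}|x\rangle\otimes|\psi_t(x)\rangle$ with $|\psi_t(x)\rangle\in\mathbb{C}^3=\operatorname{span}\{|0\rangle,|1\rangle,|2\rangle\}$, and which evolves by $|\Psi_{t+1}\rangle=\tilde S\tilde C|\Psi_t\rangle$, where $\tilde C=\sum_{x}|x\rangle\langle x|\otimes C(\theta)$, $$C(\theta)=\begin{pmatrix}-\frac{1+c}{2}&\frac{s}{\sqrt2}&\frac{1-c}{2}\\ \frac{s}{\sqrt2}&c&\frac{s}{\sqrt2}\\ \frac{1-c}{2}&\frac{s}{\sqrt2}&-\frac{1+c}{2}\end{pmatrix},$$ $$\tilde S=\sum_{x}\bigl(|x-1\rangle\langle x|\otimes|0\rangle\langle0|+|x\rangle\langle x|\otimes|1\rangle\langle1|+|x+1\rangle\langle x|\otimes|2\rangle\langle2|\bigr).$$ Let the walk start from $|\Psi_0\rangle=|0\rangle\otimes(\alpha|0\rangle+\beta|1\rangle+\gamma|2\rangle)$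 with $\alpha,\beta,\gamma\in\mathbb{C}$, $|\alpha|^2+|\beta|^2+|\gamma|^2=1$, and let $\mathbb{P}(X_t=x)=\||\psi_t(x)\rangle\|^2$ be the probability of finding the walker at $x$ at time $t$. Put $$\nu=\frac{-(3-c)+2\sqrt{2(1-c)}}{1+c},\qquad A=2(1-c)\alpha+\sqrt2\,s\beta,\qquad B=\sqrt2\,s\beta+2(1-c)\gamma.$$ Then $\nu\in(-1,0)$, and for every $x\in\mathbb{Z}$ the limit $\lim_{t\to\infty}\mathbb{P}(X_t=x)$ exists and $$\lim_{t\to\infty}\mathbb{P}(X_t=x)=\frac{1}{64(1-c)^2}\Bigl\{2(1-c)\bigl|B\nu^{|x+1|}+A\nu^{|x|}\bigr|^2+(1+c)\bigl|B\nu^{|x+1|}+(A+B)\nu^{|x|}+A\nu^{|x-1|}\bigr|^2+2(1-c)\bigl|B\nu^{|x|}+A\nu^{|x-1|}\bigr|^2\Bigr\}.$$ In particular the limit measure decays exponentially: there is a constant $K$ (independent of $x$) such that $\lim_{t\to\infty}\mathbb{P}(X_t=x)\le K\,|\nu|^{2|x|}$ for all $x\in\mathbb{Z}$. -/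

import Mathlib

open Filter Topology

noncomputable section

namespace ThreeStateWalk

/-- A state of the walk on the line: the vector of amplitudes
`∑ x, |x⟩ ⊗ (ψ x 0 |0⟩ + ψ x 1 |1⟩ + ψ x 2 |2⟩)`. -/
abbrev State : Type := ℤ → Fin 3 → ℂ

/-- The coin matrix `C(θ)`; the entry in row `i` and column `j` is the coefficient of `|i⟩⟨j|`. -/
def coin (θ : ℝ) : Matrix (Fin 3) (Fin 3) ℂ :=
  (!![-((1 + Real.cos θ) / 2), Real.sin θ / √2, (1 - Real.cos θ) / 2;
      Real.sin θ / √2, Real.cos θ, Real.sin θ / √2;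
      (1 - Real.cos θ) / 2, Real.sin θ / √2, -((1 + Real.cos θ) / 2)] :
    Matrix (Fin 3) (Fin 3) ℝ).map Complex.ofReal

/-- The operator `∑ x, |x⟩⟨x| ⊗ C(θ)`: the coin acts at every site. -/
def coinOp (θ : ℝ) (ψ : State) : State := fun x => (coin θ).mulVec (ψ x)

/-- The shift `∑ x, |x-1⟩⟨x| ⊗ |0⟩⟨0| + |x⟩⟨x| ⊗ |1⟩⟨1| + |x+1⟩⟨x| ⊗ |2⟩⟨2|`:
coin state `0` moves to the left, `1` stays, `2` moves to the right. -/
def shiftOp (ψ : State) : State := fun x => ![ψ (x + 1) 0, ψ x 1, ψ (x - 1) 2]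

/-- The initial state `|0⟩ ⊗ (α|0⟩ + β|1⟩ + γ|2⟩)`. -/
def initial (α β γ : ℂ) : State := fun x => if x = 0 then ![α, β, γ] else 0

/-- The state at time `t`. -/
def state (θ : ℝ) (α β γ : ℂ) : ℕ → State
  | 0 => initial α β γ
  | t + 1 => shiftOp (coinOp θ (state θ α β γ t))

/-- `P(X_t = x)`: the probability of finding the walker at position `x` at time `t`. -/
def prob (θ : ℝ) (α β γ : ℂ) (t : ℕ) (x : ℤ) : ℝ :=
  ∑ j : Fin 3, ‖state θ α β γ t x j‖ ^ 2

end ThreeStateWalk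

end

/-!
Translation invariance turns the walk into a rotation problem at each wave number `k`: the amplitude
of `state t` at `x` is the Fourier coefficient `(2π)⁻¹ ∫ exp (i k x) U(k)ᵗ v dk` (`state_eq_coeff`),
where `U(k)` is the unitary matrix `stepMatrix` and `v` is the initial coin vector. The eigenvalues of
`U(k)` are `1` and `exp (± i ω(k))` with `2 cos ω(k) = c - 1 - (1 + c) cos k`.

The eigenvalue `1` does not depend on `k`. The projection `p(k)` of `v` onto its eigenspace is
therefore not moved by the walk, and its Fourier coefficients are the limit amplitudes. It is a
trigonometric polynomial times `(2 - 2 cos ω(k))⁻¹`, and the Fourier coefficients of the latter solve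
a three-term recurrence whose only bounded solutions are multiples of `ν ^ |n|` (`coeff_resolvent`);
this gives the closed formula (`coeff_stationaryPart`).

On the remainder `w = v - p` one has `U² w + w = 2 cos ω U w`, and unitarity yields
`‖U w - cos ω w‖ = |sin ω| ‖w‖` (`sum_norm_sq_mulVec_sub_smul`). Hence
`g = (U w - cos ω w) / sin ω` stays bounded, even at `k = 0` where `sin ω` vanishes, and `w ∓ i g` are
eigenvectors with eigenvalues `exp (± i ω)`. Their contribution to the amplitudes is an integral of
`exp (± i t ω(k))` against a bounded function of `k`. Since `ω` is smooth and strictly monotone on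
`(0, π)`, it can be taken as the variable of integration, and the Riemann-Lebesgue lemma shows that
this contribution tends to `0` (`tendsto_integral_exp_freq`).
-/

namespace ThreeStateWalk

open MeasureTheory Complex

/-! ### The dispersion relation -/

/-- Half the sum of the two eigenvalues other than `1` of the walk at wave number `k`, where `c`
is the cosine of the coin angle. -/
noncomputable def halfTrace (c k : ℝ) : ℝ := (c - 1 - (1 + c) * Real.cos k) / 2

/-- The frequency `ω(k) ∈ [0, π]` for which the eigenvalues other than `1` of the walk at wave
number `k` are `exp (± i ω(k))`. -/
noncomputable def freq (c k : ℝ) : ℝ := Real.arccos (halfTrace c k)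

/-- The inverse of `freq c` on `[0, π]`. -/
noncomputable def waveNumber (c w : ℝ) : ℝ := Real.arccos ((c - 1 - 2 * Real.cos w) / (1 + c))

lemma continuous_halfTrace (c : ℝ) : Continuous (halfTrace c) := by
  unfold halfTrace; fun_prop

lemma continuous_freq (c : ℝ) : Continuous (freq c) :=
  Real.continuous_arccos.comp (continuous_halfTrace c)

lemma freq_neg (c k : ℝ) : freq c (-k) = freq c k := by
  simp [freq, halfTrace]

lemma halfTrace_lt_one {c : ℝ} (h1 : -1 < c) (h2 : c < 1) (k : ℝ) : halfTrace c k < 1 := by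
  unfold halfTrace
  nlinarith [Real.neg_one_le_cos k]

lemma neg_one_le_halfTrace {c : ℝ} (h1 : -1 < c) (k : ℝ) : -1 ≤ halfTrace c k := by
  unfold halfTrace
  nlinarith [Real.cos_le_one k]

lemma cos_freq {c : ℝ} (h1 : -1 < c) (h2 : c < 1) (k : ℝ) :
    Real.cos (freq c k) = halfTrace c k :=
  Real.cos_arccos (neg_one_le_halfTrace h1 k) (halfTrace_lt_one h1 h2 k).le

lemma halfTrace_inverse {c : ℝ} (h1 : -1 < c) (h2 : c < 1) (k : ℝ) :
    (c - 1 - 2 * Real.cos (freq c k)) / (1 + c) = Real.cos k := by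
  have : 1 + c ≠ 0 := by linarith
  rw [cos_freq h1 h2, halfTrace]
  field_simp
  ring

lemma waveNumber_freq {c : ℝ} (h1 : -1 < c) (h2 : c < 1) {k : ℝ} (hk : k ∈ Set.Icc 0 Real.pi) :
    waveNumber c (freq c k) = k := by
  rw [waveNumber, halfTrace_inverse h1 h2, Real.arccos_cos hk.1 hk.2]

/-! ### Decay of oscillatory integrals -/

lemma tendsto_integral_exp_mul_I (f : ℝ → ℂ) :
    Tendsto (fun r : ℝ => ∫ w : ℝ, cexp (r * w * I) * f w) (cocompact ℝ) (𝓝 0) := by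
  have hpi : (-(2 * Real.pi))⁻¹ ≠ 0 := by simp [Real.pi_ne_zero]
  have h := (Real.tendsto_integral_exp_smul_cocompact f).comp
    (Homeomorph.mulLeft₀ _ hpi).isClosedEmbedding.tendsto_cocompact
  refine h.congr fun r => integral_congr_ae (Eventually.of_forall fun w => ?_)
  simp only [Circle.smul_def, Real.fourierChar_apply, smul_eq_mul, Homeomorph.coe_mulLeft₀]
  congr 2
  push_cast
  have : (Real.pi : ℂ) ≠ 0 := by simp [Real.pi_ne_zero]
  field_simp

/-- The frequency is a smooth strictly monotone function of the wave number in `(0, π)`, so it can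
be taken as the variable of integration, and the Riemann-Lebesgue lemma applies. -/
lemma tendsto_integral_exp_freq {c : ℝ} (h1 : -1 < c) (h2 : c < 1) (f : ℝ → ℂ) :
    Tendsto (fun r : ℝ => ∫ k in (0 : ℝ)..Real.pi, cexp (r * freq c k * I) * f k)
      (cocompact ℝ) (𝓝 0) := by
  set S : Set ℝ := freq c '' Set.Ioo 0 Real.pi with hS
  have hleft : Set.LeftInvOn (waveNumber c) (freq c) (Set.Ioo 0 Real.pi) := fun k hk =>
    waveNumber_freq h1 h2 (Set.Ioo_subset_Icc_self hk)
  have hright : ∀ w ∈ S, freq c (waveNumber c w) = w := by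
    rintro _ ⟨k, hk, rfl⟩
    rw [hleft hk]
  have hSm : MeasurableSet S :=
    measurableSet_Ioo.image_of_continuousOn_injOn (continuous_freq c).continuousOn hleft.injOn
  have himage : waveNumber c '' S = Set.Ioo 0 Real.pi := hleft.image_image
  have hinj : Set.InjOn (waveNumber c) S := by
    intro w hw w' hw' h
    rw [← hright w hw, h, hright w' hw']
  have hderiv : ∀ w ∈ S, HasDerivWithinAt (waveNumber c)
      (deriv (waveNumber c) w) S w := by
    rintro _ ⟨k, hk, rfl⟩
    refine DifferentiableAt.hasDerivAt ?_ |>.hasDerivWithinAt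
    have hcos := halfTrace_inverse h1 h2 k
    have hlt : Real.cos k < 1 := by
      simpa using Real.cos_lt_cos_of_nonneg_of_le_pi le_rfl hk.2.le hk.1
    have hgt : -1 < Real.cos k := by
      simpa using Real.cos_lt_cos_of_nonneg_of_le_pi hk.1.le le_rfl hk.2
    unfold waveNumber
    refine DifferentiableAt.comp (freq c k) (g := Real.arccos) ?_ (by fun_prop)
    rw [hcos]
    exact (Real.hasDerivAt_arccos hgt.ne' hlt.ne).differentiableAt
  -- the integral over `k` is the one over `w = ω(k)`, with the Jacobian moved into the amplitude
  refine (tendsto_integral_exp_mul_I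
    (S.indicator fun w => ((|deriv (waveNumber c) w| : ℝ) : ℂ) * f (waveNumber c w))).congr
      fun r => ?_
  rw [intervalIntegral.integral_of_le Real.pi_pos.le, integral_Ioc_eq_integral_Ioo, ← himage,
    integral_image_eq_integral_abs_deriv_smul hSm hderiv hinj, ← integral_indicator hSm]
  refine integral_congr_ae (Eventually.of_forall fun w => ?_)
  by_cases hw : w ∈ S
  · simp only [Set.indicator_of_mem hw, hright w hw, real_smul]
    ring
  · simp [Set.indicator_of_notMem hw]

lemma tendsto_integral_exp_freq_symm {c : ℝ} (h1 : -1 < c) (h2 : c < 1) {f : ℝ → ℂ}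
    (hf : IntervalIntegrable f volume (-Real.pi) Real.pi) :
    Tendsto (fun r : ℝ => ∫ k in (-Real.pi)..Real.pi, cexp (r * freq c k * I) * f k)
      (cocompact ℝ) (𝓝 0) := by
  have hpi := Real.pi_pos
  have h := (tendsto_integral_exp_freq h1 h2 fun k => f (-k)).add
    (tendsto_integral_exp_freq h1 h2 f)
  rw [add_zero] at h
  refine h.congr fun r => ?_
  have hint : IntervalIntegrable (fun k => cexp (r * freq c k * I) * f k) volume
      (-Real.pi) Real.pi := by
    refine hf.continuousOn_mul (Continuous.continuousOn ?_)
    have := continuous_freq c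
    fun_prop
  have h0 : (0 : ℝ) ∈ Set.uIcc (-Real.pi) Real.pi :=
    Set.mem_uIcc.2 (Or.inl ⟨by linarith, hpi.le⟩)
  rw [← intervalIntegral.integral_add_adjacent_intervals (b := 0)
    (hint.mono_set (Set.uIcc_subset_uIcc Set.left_mem_uIcc h0))
    (hint.mono_set (Set.uIcc_subset_uIcc h0 Set.right_mem_uIcc))]
  congr 1
  have := intervalIntegral.integral_comp_neg (a := 0) (b := Real.pi)
    (fun k => cexp (r * freq c k * I) * f k)
  simpa [freq_neg] using this

/-! ### Fourier coefficients -/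

/-- The character `k ↦ exp (i n k)`. -/
noncomputable def phase (n : ℤ) (k : ℝ) : ℂ := cexp (n * k * I)

/-- The coefficient `(2π)⁻¹ ∫ exp (i n k) f(k) dk` over a period. -/
noncomputable def coeff (f : ℝ → ℂ) (n : ℤ) : ℂ :=
  (2 * Real.pi)⁻¹ * ∫ k in (-Real.pi)..Real.pi, phase n k * f k

lemma continuous_phase (n : ℤ) : Continuous (phase n) := by
  unfold phase; fun_prop

lemma phase_zero (k : ℝ) : phase 0 k = 1 := by simp [phase]

lemma phase_add (m n : ℤ) (k : ℝ) : phase (m + n) k = phase m k * phase n k := by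
  simp only [phase, ← Complex.exp_add]
  congr 1
  push_cast
  ring

lemma norm_phase (n : ℤ) (k : ℝ) : ‖phase n k‖ = 1 := by
  have := Complex.norm_exp_ofReal_mul_I (n * k)
  push_cast at this
  exact this

lemma conj_phase (n : ℤ) (k : ℝ) : (starRingEnd ℂ) (phase n k) = phase (-n) k := by
  simp only [phase, ← Complex.exp_conj]
  congr 1
  simp

lemma phase_mul_phase_neg (n : ℤ) (k : ℝ) : phase n k * phase (-n) k = 1 := by
  rw [← phase_add, add_neg_cancel, phase_zero]

lemma phase_one_add_phase_neg_one (k : ℝ) :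
    phase 1 k + phase (-1) k = 2 * (Real.cos k : ℂ) := by
  rw [Complex.ofReal_cos, Complex.two_cos]
  simp [phase]

lemma coeff_add {f g : ℝ → ℂ} (hf : IntervalIntegrable f volume (-Real.pi) Real.pi)
    (hg : IntervalIntegrable g volume (-Real.pi) Real.pi) (n : ℤ) :
    coeff (fun k => f k + g k) n = coeff f n + coeff g n := by
  have h := (continuous_phase n).continuousOn (s := Set.uIcc (-Real.pi) Real.pi)
  simp only [coeff, mul_add]
  rw [intervalIntegral.integral_add (hf.continuousOn_mul h) (hg.continuousOn_mul h), mul_add]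

lemma coeff_const_mul (a : ℂ) (f : ℝ → ℂ) (n : ℤ) :
    coeff (fun k => a * f k) n = a * coeff f n := by
  simp only [coeff, mul_left_comm _ a, intervalIntegral.integral_const_mul]

lemma coeff_phase_mul (m : ℤ) (f : ℝ → ℂ) (n : ℤ) :
    coeff (fun k => phase m k * f k) n = coeff f (n + m) := by
  simp only [coeff, phase_add, mul_assoc]

lemma coeff_const (a : ℂ) (n : ℤ) : coeff (fun _ => a) n = if n = 0 then a else 0 := by
  have hpi : (Real.pi : ℂ) ≠ 0 := by simp [Real.pi_ne_zero]
  split_ifs with h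
  · subst h
    simp only [coeff, phase_zero, one_mul, intervalIntegral.integral_const, real_smul]
    push_cast
    field_simp
    ring
  · have hn : (n * I : ℂ) ≠ 0 := mul_ne_zero (by exact_mod_cast h) I_ne_zero
    have hrw : ∀ k : ℝ, phase n k = cexp (n * I * k) := fun k => by
      rw [phase]; congr 1; ring
    have hper : cexp (n * I * (Real.pi : ℝ)) = cexp (n * I * (-Real.pi : ℝ)) := by
      rw [Complex.exp_eq_exp_iff_exists_int]
      exact ⟨n, by push_cast; ring⟩
    simp only [coeff, intervalIntegral.integral_mul_const, hrw]
    rw [integral_exp_mul_complex hn, hper]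
    simp

lemma norm_coeff_le {f : ℝ → ℂ} {M : ℝ} (hf : ∀ k, ‖f k‖ ≤ M) (n : ℤ) : ‖coeff f n‖ ≤ M := by
  have h := intervalIntegral.norm_integral_le_of_norm_le_const (a := -Real.pi) (b := Real.pi)
    (f := fun k => phase n k * f k) (C := M) fun k _ => by
      rw [norm_mul, norm_phase, one_mul]; exact hf k
  have hpi := Real.pi_pos
  rw [coeff, norm_mul, Complex.norm_real, Real.norm_of_nonneg (by positivity),
    inv_mul_le_iff₀ (by positivity)]
  rwa [sub_neg_eq_add, abs_of_pos (by positivity), ← two_mul, mul_comm] at h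

lemma coeff_even {f : ℝ → ℂ} (hf : ∀ k, f (-k) = f k) (n : ℤ) : coeff f (-n) = coeff f n := by
  have h := intervalIntegral.integral_comp_neg (a := -Real.pi) (b := Real.pi)
    (fun k => phase n k * f k)
  rw [neg_neg] at h
  rw [coeff, coeff, ← h]
  congr 2
  ext k
  rw [hf]
  congr 1
  simp [phase]

/-! ### The Fourier coefficients of the resolvent -/

/-- A three-term recurrence with characteristic roots `r` and `r⁻¹` has, up to a factor, only one
bounded solution. -/
lemma eq_pow_mul_of_bounded_recurrence {r : ℂ} (h0 : r ≠ 0) (h1 : ‖r‖ < 1) {J : ℕ → ℂ} {M : ℝ}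
    (hM : ∀ n, ‖J n‖ ≤ M) (hrec : ∀ n, r * (J (n + 2) + J n) = (r ^ 2 + 1) * J (n + 1)) (n : ℕ) :
    J n = r ^ n * J 0 := by
  -- `J (n + 1) - r J n` is the component along the growing solution `r ^ (-n)`
  have he : ∀ n, J 1 - r * J 0 = r ^ n * (J (n + 1) - r * J n) := by
    intro n
    induction n with
    | zero => simp
    | succ n ih =>
      rw [ih]
      linear_combination (-r ^ n) * hrec n
  have hlim : Tendsto (fun n : ℕ => r ^ n * (J (n + 1) - r * J n)) atTop (𝓝 0) := by
    refine (tendsto_pow_atTop_nhds_zero_of_norm_lt_one h1).zero_mul_isBoundedUnder_le ?_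
    refine isBoundedUnder_of ⟨M + ‖r‖ * M, fun n => ?_⟩
    refine (norm_sub_le _ _).trans (add_le_add (hM _) ?_)
    rw [norm_mul]
    exact mul_le_mul_of_nonneg_left (hM n) (norm_nonneg r)
  have hzero : J 1 - r * J 0 = 0 :=
    tendsto_nhds_unique (tendsto_const_nhds.congr he) hlim
  induction n with
  | zero => simp
  | succ n ih =>
    have h := he n
    rw [hzero, eq_comm, mul_eq_zero, or_iff_right (pow_ne_zero n h0), sub_eq_zero] at h
    rw [h, ih, pow_succ']
    ring

/-- The rate `ν` of the spatial decay of the stationary state. -/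
noncomputable def decayRate (c : ℝ) : ℝ := (-(3 - c) + 2 * √(2 * (1 - c))) / (1 + c)

lemma decayRate_mem {c : ℝ} (h1 : -1 < c) (h2 : c < 1) : decayRate c ∈ Set.Ioo (-1 : ℝ) 0 := by
  have hpos : 0 < 1 + c := by linarith
  have hsq : √(2 * (1 - c)) ^ 2 = 2 * (1 - c) := Real.sq_sqrt (by linarith)
  have h0 : 0 < √(2 * (1 - c)) := Real.sqrt_pos.2 (by linarith)
  -- for `y = √(2 (1 - c))` the lower bound amounts to `y ^ 2 < 2 y`, the upper one to
  -- `0 < (y - 2) ^ 2`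
  have hlt : √(2 * (1 - c)) < 2 := by nlinarith
  constructor
  · rw [decayRate, lt_div_iff₀ hpos]
    nlinarith
  · rw [decayRate, div_lt_iff₀ hpos]
    nlinarith

lemma one_add_mul_decayRate {c : ℝ} (h1 : -1 < c) :
    (1 + c) * decayRate c = -(3 - c) + 2 * √(2 * (1 - c)) := by
  have : 1 + c ≠ 0 := by linarith
  rw [decayRate]
  field_simp

lemma decayRate_quadratic {c : ℝ} (h1 : -1 < c) (h2 : c < 1) :
    (1 + c) * (decayRate c ^ 2 + 1) = -(2 * (3 - c)) * decayRate c := by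
  have hpos : 1 + c ≠ 0 := by linarith
  have hsq : √(2 * (1 - c)) ^ 2 = 2 * (1 - c) := Real.sq_sqrt (by linarith)
  have h := one_add_mul_decayRate h1
  apply mul_left_cancel₀ hpos
  linear_combination ((1 + c) * decayRate c + (3 - c) + 2 * √(2 * (1 - c))) * h + 4 * hsq

/-- The function `(2 - 2 cos ω(k))⁻¹`, the only factor of the stationary part that is not a
trigonometric polynomial. -/
noncomputable def resolvent (c k : ℝ) : ℂ := ((2 - 2 * halfTrace c k : ℝ) : ℂ)⁻¹

lemma two_sub_halfTrace_ne_zero {c : ℝ} (h1 : -1 < c) (h2 : c < 1) (k : ℝ) :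
    ((2 - 2 * halfTrace c k : ℝ) : ℂ) ≠ 0 := by
  have := halfTrace_lt_one h1 h2 k
  exact_mod_cast (by linarith : (2 - 2 * halfTrace c k : ℝ) ≠ 0)

lemma continuous_resolvent {c : ℝ} (h1 : -1 < c) (h2 : c < 1) : Continuous (resolvent c) := by
  refine Continuous.inv₀ ?_ (two_sub_halfTrace_ne_zero h1 h2)
  have := continuous_halfTrace c
  fun_prop

lemma norm_resolvent_le {c : ℝ} (h1 : -1 < c) (h2 : c < 1) (k : ℝ) :
    ‖resolvent c k‖ ≤ (2 * (1 - c))⁻¹ := by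
  have h : 2 * (1 - c) ≤ 2 - 2 * halfTrace c k := by
    unfold halfTrace
    nlinarith [Real.neg_one_le_cos k]
  rw [resolvent, norm_inv, Complex.norm_real, Real.norm_of_nonneg (by linarith)]
  exact inv_anti₀ (by linarith) h

/-- The Fourier coefficients of the identity `(2 - 2 cos ω) (2 - 2 cos ω)⁻¹ = 1`. -/
lemma coeff_resolvent_recurrence {c : ℝ} (h1 : -1 < c) (h2 : c < 1) (n : ℤ) :
    (3 - c) * coeff (resolvent c) n
      + (1 + c) / 2 * (coeff (resolvent c) (n + 1) + coeff (resolvent c) (n - 1))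
      = if n = 0 then 1 else 0 := by
  have hc := continuous_resolvent h1 h2
  have hp := continuous_phase 1
  have hm := continuous_phase (-1)
  have hi : ∀ {f : ℝ → ℂ}, Continuous f → IntervalIntegrable f volume (-Real.pi) Real.pi :=
    fun hf => hf.intervalIntegrable _ _
  have hone : (fun k => (3 - c) * resolvent c k + ((1 + c) / 2 * (phase 1 k * resolvent c k)
      + (1 + c) / 2 * (phase (-1) k * resolvent c k))) = fun _ => (1 : ℂ) := by
    ext k
    have hne := two_sub_halfTrace_ne_zero h1 h2 k
    have h := phase_one_add_phase_neg_one k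
    have hd : ((2 - 2 * halfTrace c k : ℝ) : ℂ)
        = (3 - c) + (1 + c) / 2 * (phase 1 k + phase (-1) k) := by
      rw [h, halfTrace]
      push_cast
      ring
    have hinv : ((2 - 2 * halfTrace c k : ℝ) : ℂ) * resolvent c k = 1 := mul_inv_cancel₀ hne
    rw [hd] at hinv
    linear_combination hinv
  rw [← coeff_const 1 n, ← hone, coeff_add (hi (by fun_prop)) (hi (by fun_prop)),
    coeff_add (hi (by fun_prop)) (hi (by fun_prop)), coeff_const_mul, coeff_const_mul,
    coeff_const_mul, coeff_phase_mul, coeff_phase_mul]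
  ring_nf

lemma coeff_resolvent {c : ℝ} (h1 : -1 < c) (h2 : c < 1) (n : ℤ) :
    coeff (resolvent c) n
      = ((2 * √(2 * (1 - c)) : ℝ) : ℂ)⁻¹ * (decayRate c : ℂ) ^ n.natAbs := by
  set J := coeff (resolvent c) with hJ
  have hν := decayRate_mem h1 h2
  have hne : (decayRate c : ℂ) ≠ 0 := by exact_mod_cast hν.2.ne
  have hlt : ‖(decayRate c : ℂ)‖ < 1 := by
    rw [Complex.norm_real, Real.norm_eq_abs, abs_lt]
    exact ⟨hν.1, by linarith [hν.2]⟩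
  have hev : ∀ n, J (-n) = J n := coeff_even fun k => by simp [resolvent, halfTrace]
  have hc : (1 + c : ℂ) ≠ 0 := by exact_mod_cast (by linarith : 1 + c ≠ 0)
  have hpow : ∀ n : ℕ, J n = (decayRate c : ℂ) ^ n * J 0 := by
    refine eq_pow_mul_of_bounded_recurrence hne hlt (J := fun n : ℕ => J n)
      (fun n => norm_coeff_le (norm_resolvent_le h1 h2) n) fun n => ?_
    have h := coeff_resolvent_recurrence h1 h2 (n + 1)
    rw [if_neg (by omega), ← hJ, add_assoc, add_sub_cancel_right, one_add_one_eq_two] at h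
    have hq : (1 + c : ℂ) * ((decayRate c : ℂ) ^ 2 + 1) = -(2 * (3 - c)) * decayRate c := by
      exact_mod_cast decayRate_quadratic h1 h2
    push_cast
    apply mul_left_cancel₀ hc
    linear_combination 2 * (decayRate c : ℂ) * h - J (n + 1) * hq
  have hzero : J 0 = ((2 * √(2 * (1 - c)) : ℝ) : ℂ)⁻¹ := by
    have h := coeff_resolvent_recurrence h1 h2 0
    have hs : (1 + c : ℂ) * decayRate c = -(3 - c) + (2 * √(2 * (1 - c)) : ℝ) := by
      exact_mod_cast one_add_mul_decayRate h1
    have hJ1 := hpow 1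
    rw [Nat.cast_one, pow_one] at hJ1
    rw [if_pos rfl, ← hJ, zero_add, zero_sub, hev, hJ1] at h
    refine eq_inv_of_mul_eq_one_left ?_
    linear_combination h - J 0 * hs
  obtain hn | hn := Int.natAbs_eq n
  · rw [hn, hpow, hzero, Int.natAbs_natCast, mul_comm]
  · rw [hn, hev, hpow, hzero, Int.natAbs_neg, Int.natAbs_natCast, mul_comm]

open Matrix

/-! ### The walk at a fixed wave number -/

/-- The action of one step of the walk on the amplitudes of wave number `k`. -/
noncomputable def stepMatrix (θ k : ℝ) : Matrix (Fin 3) (Fin 3) ℂ :=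
  diagonal ![phase 1 k, 1, phase (-1) k] * coin θ

lemma ofReal_sqrt_two_sq : ((√2 : ℝ) : ℂ) ^ 2 = 2 := by
  exact_mod_cast Real.sq_sqrt (zero_le_two (α := ℝ))

lemma ofReal_sqrt_two_ne_zero : ((√2 : ℝ) : ℂ) ≠ 0 := by
  simp

lemma ofReal_sin_sq (θ : ℝ) : (Real.sin θ : ℂ) ^ 2 = 1 - (Real.cos θ : ℂ) ^ 2 := by
  exact_mod_cast Real.sin_sq θ

lemma sin_div_sqrt_two_sq (θ : ℝ) :
    ((Real.sin θ : ℂ) / (√2 : ℝ)) ^ 2 = (1 - (Real.cos θ : ℂ) ^ 2) / 2 := by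
  rw [div_pow, ofReal_sqrt_two_sq, ofReal_sin_sq]

/-- The coin matrix with its entries displayed as complex numbers. -/
lemma coin_eq (θ : ℝ) : coin θ =
    !![-((1 + (Real.cos θ : ℂ)) / 2), (Real.sin θ : ℂ) / (√2 : ℝ), (1 - (Real.cos θ : ℂ)) / 2;
      (Real.sin θ : ℂ) / (√2 : ℝ), (Real.cos θ : ℂ), (Real.sin θ : ℂ) / (√2 : ℝ);
      (1 - (Real.cos θ : ℂ)) / 2, (Real.sin θ : ℂ) / (√2 : ℝ),
        -((1 + (Real.cos θ : ℂ)) / 2)] := by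
  ext i j
  fin_cases i <;> fin_cases j <;> simp [coin]

lemma coin_conjTranspose_mul (θ : ℝ) : (coin θ)ᴴ * coin θ = 1 := by
  have h : (coin θ)ᴴ = coin θ := by
    ext i j
    rw [conjTranspose_apply, coin, map_apply, map_apply, RCLike.star_def, conj_ofReal]
    congr 1
    fin_cases i <;> fin_cases j <;> rfl
  have hq := sin_div_sqrt_two_sq θ
  rw [h, coin_eq]
  generalize (Real.sin θ : ℂ) / (√2 : ℝ) = q at hq ⊢
  generalize (Real.cos θ : ℂ) = c at hq ⊢
  ext i j
  fin_cases i <;> fin_cases j <;> simp [mul_apply, Fin.sum_univ_three]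
  · linear_combination hq
  · ring
  · linear_combination hq
  · ring
  · linear_combination 2 * hq
  · ring
  · linear_combination hq
  · ring
  · linear_combination hq

lemma stepMatrix_conjTranspose_mul (θ k : ℝ) : (stepMatrix θ k)ᴴ * stepMatrix θ k = 1 := by
  have hd : (diagonal ![phase 1 k, 1, phase (-1) k])ᴴ * diagonal ![phase 1 k, 1, phase (-1) k]
      = (1 : Matrix (Fin 3) (Fin 3) ℂ) := by
    have h := phase_mul_phase_neg 1 k
    rw [diagonal_conjTranspose, diagonal_mul_diagonal, ← diagonal_one]
    congr 1
    ext i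
    fin_cases i <;> simp [conj_phase, h, mul_comm (phase (-1) k)]
  rw [stepMatrix, conjTranspose_mul, Matrix.mul_assoc, ← Matrix.mul_assoc _ _ (coin θ), hd,
    Matrix.one_mul, coin_conjTranspose_mul]

lemma stepMatrix_mulVec (θ k : ℝ) (v : Fin 3 → ℂ) : stepMatrix θ k *ᵥ v =
    ![phase 1 k * (coin θ *ᵥ v) 0, (coin θ *ᵥ v) 1, phase (-1) k * (coin θ *ᵥ v) 2] := by
  rw [stepMatrix, ← mulVec_mulVec]
  ext i
  fin_cases i <;> simp [mulVec_diagonal]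

lemma star_dotProduct_self (w : Fin 3 → ℂ) : star w ⬝ᵥ w = ((∑ j, ‖w j‖ ^ 2 : ℝ) : ℂ) := by
  simp [dotProduct, ← Complex.conj_mul']

/-- If a unitary matrix `U` satisfies `U² + 1 = 2 τ U` on a vector, then `U - τ` acts on that
vector as `√(1 - τ²)` times an isometry. -/
lemma sum_norm_sq_mulVec_sub_smul {U : Matrix (Fin 3) (Fin 3) ℂ} (hU : Uᴴ * U = 1) {τ : ℝ}
    {w : Fin 3 → ℂ} (hw : U *ᵥ (U *ᵥ w) + w = (2 * τ : ℂ) • (U *ᵥ w)) :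
    ∑ j, ‖(U *ᵥ w - (τ : ℂ) • w) j‖ ^ 2 = (1 - τ ^ 2) * ∑ j, ‖w j‖ ^ 2 := by
  have hiso : ∀ a b : Fin 3 → ℂ, star (U *ᵥ a) ⬝ᵥ (U *ᵥ b) = star a ⬝ᵥ b := fun a b => by
    rw [star_mulVec, dotProduct_mulVec, vecMul_vecMul, hU, vecMul_one]
  have h1 := hiso w w
  -- pairing the hypothesis with `U w`
  have h2 : star w ⬝ᵥ (U *ᵥ w) + star (U *ᵥ w) ⬝ᵥ w = 2 * τ * (star w ⬝ᵥ w) := by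
    have := congrArg (star (U *ᵥ w) ⬝ᵥ ·) hw
    simpa only [dotProduct_add, hiso, dotProduct_smul, smul_eq_mul] using this
  have h3 : star (U *ᵥ w - (τ : ℂ) • w) ⬝ᵥ (U *ᵥ w - (τ : ℂ) • w)
      = (1 - (τ : ℂ) ^ 2) * (star w ⬝ᵥ w) := by
    simp only [star_sub, star_smul, sub_dotProduct, dotProduct_sub, smul_dotProduct,
      dotProduct_smul, smul_eq_mul, RCLike.star_def, conj_ofReal]
    linear_combination h1 - (τ : ℂ) * h2
  rw [star_dotProduct_self, star_dotProduct_self] at h3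
  exact_mod_cast h3

/-- The second vector of the plane of rotation: on a vector `w` with `U² w + w = 2 cos ω U w`, a
unitary `U` acts by `U w = cos ω w + sin ω g` and `U g = - sin ω w + cos ω g`. Where `sin ω = 0`
this vector is `0`, and so is `U w - cos ω w`. -/
noncomputable def conjugateVector (U : Matrix (Fin 3) (Fin 3) ℂ) (ω : ℝ) (w : Fin 3 → ℂ) :
    Fin 3 → ℂ :=
  (Real.sin ω : ℂ)⁻¹ • (U *ᵥ w - (Real.cos ω : ℂ) • w)

section Rotation

variable {U : Matrix (Fin 3) (Fin 3) ℂ} {ω : ℝ} {w : Fin 3 → ℂ}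

lemma sin_smul_conjugateVector (hU : Uᴴ * U = 1)
    (hw : U *ᵥ (U *ᵥ w) + w = (2 * Real.cos ω : ℂ) • (U *ᵥ w)) :
    (Real.sin ω : ℂ) • conjugateVector U ω w = U *ᵥ w - (Real.cos ω : ℂ) • w := by
  by_cases hs : Real.sin ω = 0
  · have h := sum_norm_sq_mulVec_sub_smul hU hw
    rw [← Real.sin_sq, hs, zero_pow two_ne_zero, zero_mul,
      Finset.sum_eq_zero_iff_of_nonneg fun _ _ => sq_nonneg _] at h
    rw [hs, ofReal_zero, zero_smul]
    ext j
    rw [Pi.zero_apply, eq_comm, ← norm_eq_zero, ← sq_eq_zero_iff]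
    exact h j (Finset.mem_univ j)
  · rw [conjugateVector, smul_inv_smul₀ (by exact_mod_cast hs)]

lemma mulVec_conjugateVector
    (hw : U *ᵥ (U *ᵥ w) + w = (2 * Real.cos ω : ℂ) • (U *ᵥ w)) :
    U *ᵥ conjugateVector U ω w
      = (Real.cos ω : ℂ) • conjugateVector U ω w - (Real.sin ω : ℂ) • w := by
  have h2 : U *ᵥ (U *ᵥ w) = (2 * Real.cos ω : ℂ) • (U *ᵥ w) - w := eq_sub_of_add_eq hw
  have hsq := ofReal_sin_sq ω
  rw [conjugateVector, mulVec_smul, mulVec_sub, mulVec_smul, h2]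
  by_cases hs : (Real.sin ω : ℂ) = 0
  · simp [hs]
  · ext j
    simp only [Pi.smul_apply, Pi.sub_apply, smul_eq_mul]
    field_simp
    linear_combination w j * hsq

lemma norm_conjugateVector_le (hU : Uᴴ * U = 1)
    (hw : U *ᵥ (U *ᵥ w) + w = (2 * Real.cos ω : ℂ) • (U *ᵥ w)) (j : Fin 3) :
    ‖conjugateVector U ω w j‖ ≤ √(∑ i, ‖w i‖ ^ 2) := by
  refine Real.le_sqrt_of_sq_le ?_
  have h := sum_norm_sq_mulVec_sub_smul hU hw
  rw [← Real.sin_sq] at h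
  have hle : ‖(U *ᵥ w - (Real.cos ω : ℂ) • w) j‖ ^ 2 ≤ Real.sin ω ^ 2 * ∑ i, ‖w i‖ ^ 2 :=
    h ▸ Finset.single_le_sum (f := fun j => ‖(U *ᵥ w - (Real.cos ω : ℂ) • w) j‖ ^ 2)
      (fun i _ => sq_nonneg _) (Finset.mem_univ j)
  rw [conjugateVector, Pi.smul_apply, smul_eq_mul, norm_mul, norm_inv, Complex.norm_real, mul_pow,
    inv_pow, Real.norm_eq_abs, sq_abs]
  by_cases hs : Real.sin ω = 0
  · rw [hs, zero_pow two_ne_zero, _root_.inv_zero, zero_mul]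
    positivity
  · rwa [inv_mul_le_iff₀ (by positivity)]

lemma mulVec_sub_I_smul (hU : Uᴴ * U = 1)
    (hw : U *ᵥ (U *ᵥ w) + w = (2 * Real.cos ω : ℂ) • (U *ᵥ w)) :
    U *ᵥ (w - I • conjugateVector U ω w) = cexp (ω * I) • (w - I • conjugateVector U ω w) := by
  have h := sin_smul_conjugateVector hU hw
  rw [mulVec_sub, mulVec_smul, mulVec_conjugateVector hw, ← sub_add_cancel (U *ᵥ w) _, ← h,
    Complex.exp_mul_I, ← ofReal_cos, ← ofReal_sin]
  ext j
  simp only [Pi.smul_apply, Pi.sub_apply, Pi.add_apply, smul_eq_mul]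
  linear_combination (Real.sin ω * conjugateVector U ω w j) * I_sq

lemma mulVec_add_I_smul (hU : Uᴴ * U = 1)
    (hw : U *ᵥ (U *ᵥ w) + w = (2 * Real.cos ω : ℂ) • (U *ᵥ w)) :
    U *ᵥ (w + I • conjugateVector U ω w)
      = cexp (-ω * I) • (w + I • conjugateVector U ω w) := by
  have h := sin_smul_conjugateVector hU hw
  rw [mulVec_add, mulVec_smul, mulVec_conjugateVector hw, ← sub_add_cancel (U *ᵥ w) _, ← h,
    Complex.exp_mul_I, Complex.cos_neg, Complex.sin_neg, ← ofReal_cos, ← ofReal_sin]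
  ext j
  simp only [Pi.smul_apply, Pi.sub_apply, Pi.add_apply, smul_eq_mul]
  linear_combination (Real.sin ω * conjugateVector U ω w j) * I_sq

end Rotation

/-! ### The stationary part -/

/-- The eigenvector with eigenvalue `1` of the step at wave number `k`. -/
noncomputable def stationaryVector (θ k : ℝ) : Fin 3 → ℂ :=
  ![1, (Real.sin θ : ℂ) / (√2 : ℝ) / (1 - Real.cos θ) * (1 + phase (-1) k), phase (-1) k]

lemma one_sub_cos_ne_zero {θ : ℝ} (h2 : Real.cos θ < 1) : (1 - (Real.cos θ : ℂ)) ≠ 0 := by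
  exact_mod_cast (by linarith : 1 - Real.cos θ ≠ 0)

lemma stepMatrix_mulVec_stationaryVector {θ : ℝ} (h2 : Real.cos θ < 1) (k : ℝ) :
    stepMatrix θ k *ᵥ stationaryVector θ k = stationaryVector θ k := by
  have hq := sin_div_sqrt_two_sq θ
  have hc := one_sub_cos_ne_zero h2
  have hz := phase_mul_phase_neg 1 k
  rw [stepMatrix_mulVec, coin_eq, stationaryVector]
  generalize (Real.sin θ : ℂ) / (√2 : ℝ) = q at *
  generalize (Real.cos θ : ℂ) = c at *
  generalize phase 1 k = z at *
  generalize phase (-1) k = y at *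
  ext i
  fin_cases i <;> simp [mulVec, dotProduct, Fin.sum_univ_three] <;> field_simp
  · linear_combination 2 * (z + z * y) * hq + 2 * (1 - c) * hz
  · ring
  · linear_combination 2 * (y + y ^ 2) * hq

/-- The inner product of the initial vector with the stationary vector, times `1 - cos θ`. -/
noncomputable def overlap (θ : ℝ) (v : Fin 3 → ℂ) (k : ℝ) : ℂ :=
  (1 - Real.cos θ) * v 0 + (Real.sin θ : ℂ) / (√2 : ℝ) * (1 + phase 1 k) * v 1
    + (1 - Real.cos θ) * phase 1 k * v 2

/-- By the Cayley-Hamilton theorem `U² - 2 cos ω U + 1` takes values in the eigenspace of `U` with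
eigenvalue `1`, which the stationary vector spans. -/
lemma stepMatrix_quadratic {θ : ℝ} (h2 : Real.cos θ < 1) (k : ℝ) (v : Fin 3 → ℂ) :
    stepMatrix θ k *ᵥ (stepMatrix θ k *ᵥ v) + v
      = (2 * halfTrace (Real.cos θ) k : ℂ) • (stepMatrix θ k *ᵥ v)
        + overlap θ v k • stationaryVector θ k := by
  have hq := sin_div_sqrt_two_sq θ
  have hc := one_sub_cos_ne_zero h2
  have hz := phase_mul_phase_neg 1 k
  have hτ : (2 * halfTrace (Real.cos θ) k : ℂ)
      = Real.cos θ - 1 - (1 + Real.cos θ) / 2 * (phase 1 k + phase (-1) k) := by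
    rw [phase_one_add_phase_neg_one, halfTrace]
    push_cast
    ring
  rw [hτ, stepMatrix_mulVec, stepMatrix_mulVec, coin_eq, stationaryVector, overlap]
  generalize (Real.sin θ : ℂ) / (√2 : ℝ) = q at *
  generalize (Real.cos θ : ℂ) = c at *
  generalize phase 1 k = z at *
  generalize phase (-1) k = y at *
  have hy : y = z⁻¹ := (inv_eq_of_mul_eq_one_right hz).symm
  have hz0 : z ≠ 0 := left_ne_zero_of_mul_eq_one hz
  ext i
  fin_cases i <;> simp [mulVec, dotProduct, Fin.sum_univ_three] <;> rw [hy] <;> field_simp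
  · linear_combination 4 * z * (v 0 + v 2) * hq
  · linear_combination ((1 - c) * (2 * z ^ 2 * v 1 + 2 * v 1) - 2 * v 1 * (1 + z) ^ 2) * hq
  · linear_combination 4 * z * (v 0 + v 2) * hq

lemma continuous_stepMatrix (θ : ℝ) : Continuous (stepMatrix θ) := by
  have h1 := continuous_phase 1
  have h2 := continuous_phase (-1)
  refine Continuous.matrix_mul (Continuous.matrix_diagonal ?_) continuous_const
  refine continuous_pi fun i => ?_
  fin_cases i
  · exact h1
  · exact continuous_const
  · exact h2

lemma continuous_stationaryVector (θ : ℝ) : Continuous (stationaryVector θ) := by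
  have h := continuous_phase (-1)
  refine continuous_pi fun i => ?_
  fin_cases i
  · exact continuous_const
  · exact continuous_const.mul (continuous_const.add h)
  · exact h

lemma continuous_overlap (θ : ℝ) (v : Fin 3 → ℂ) : Continuous (overlap θ v) := by
  have h := continuous_phase 1
  unfold overlap
  fun_prop

/-- The orthogonal projection of `v` onto the eigenspace with eigenvalue `1` of the step at wave
number `k`. -/
noncomputable def stationaryPart (θ : ℝ) (v : Fin 3 → ℂ) (k : ℝ) : Fin 3 → ℂ :=
  (resolvent (Real.cos θ) k * overlap θ v k) • stationaryVector θ k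

lemma continuous_stationaryPart {θ : ℝ} (h1 : -1 < Real.cos θ) (h2 : Real.cos θ < 1)
    (v : Fin 3 → ℂ) : Continuous (stationaryPart θ v) :=
  ((continuous_resolvent h1 h2).mul (continuous_overlap θ v)).smul (continuous_stationaryVector θ)

lemma stepMatrix_mulVec_stationaryPart {θ : ℝ} (h2 : Real.cos θ < 1) (v : Fin 3 → ℂ) (k : ℝ) :
    stepMatrix θ k *ᵥ stationaryPart θ v k = stationaryPart θ v k := by
  rw [stationaryPart, mulVec_smul, stepMatrix_mulVec_stationaryVector h2]

/-- On the complement of the stationary part the eigenvalues `exp (± i ω)` are the only ones left. -/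
lemma stepMatrix_quadratic_sub_stationaryPart {θ : ℝ} (h1 : -1 < Real.cos θ)
    (h2 : Real.cos θ < 1) (v : Fin 3 → ℂ) (k : ℝ) :
    stepMatrix θ k *ᵥ (stepMatrix θ k *ᵥ (v - stationaryPart θ v k)) + (v - stationaryPart θ v k)
      = (2 * Real.cos (freq (Real.cos θ) k) : ℂ) •
        (stepMatrix θ k *ᵥ (v - stationaryPart θ v k)) := by
  have hq := stepMatrix_quadratic h2 k v
  have hr : ((2 - 2 * halfTrace (Real.cos θ) k : ℝ) : ℂ) * resolvent (Real.cos θ) k = 1 :=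
    mul_inv_cancel₀ (two_sub_halfTrace_ne_zero h1 h2 k)
  push_cast [-ofReal_cos] at hr
  rw [cos_freq h1 h2, mulVec_sub, mulVec_sub]
  simp only [stepMatrix_mulVec_stationaryPart h2]
  ext j
  have hj := congrFun hq j
  simp only [Pi.add_apply, Pi.smul_apply, smul_eq_mul] at hj
  simp only [stationaryPart, Pi.add_apply, Pi.sub_apply, Pi.smul_apply, smul_eq_mul]
  linear_combination hj - overlap θ v k * stationaryVector θ k j * hr

/-! ### Fourier representation and limit of the walk -/

lemma state_eq_coeff (θ : ℝ) (α β γ : ℂ) (t : ℕ) (x : ℤ) (j : Fin 3) :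
    state θ α β γ t x j = coeff (fun k => (stepMatrix θ k ^ t *ᵥ ![α, β, γ]) j) x := by
  induction t generalizing x j with
  | zero =>
    simp only [pow_zero, one_mulVec, coeff_const]
    rw [state, initial]
    split_ifs <;> rfl
  | succ t ih =>
    have hint : ∀ i, IntervalIntegrable (fun k => (stepMatrix θ k ^ t *ᵥ ![α, β, γ]) i) volume
        (-Real.pi) Real.pi := fun i => by
      have h := continuous_stepMatrix θ
      refine Continuous.intervalIntegrable ?_ _ _
      exact (continuous_apply i).comp ((h.pow t).matrix_mulVec continuous_const)
    have hcoin : ∀ (i : Fin 3) (y : ℤ), coinOp θ (state θ α β γ t) y i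
        = coeff (fun k => (coin θ *ᵥ (stepMatrix θ k ^ t *ᵥ ![α, β, γ])) i) y := fun i y => by
      simp only [coinOp, mulVec, dotProduct, Fin.sum_univ_three] at hint ⊢
      simp only [ih, mulVec, dotProduct, Fin.sum_univ_three]
      rw [coeff_add (((hint 0).const_mul _).add ((hint 1).const_mul _)) ((hint 2).const_mul _),
        coeff_add ((hint 0).const_mul _) ((hint 1).const_mul _), coeff_const_mul, coeff_const_mul,
        coeff_const_mul]
    rw [state]
    simp only [pow_succ', ← mulVec_mulVec, stepMatrix_mulVec]
    rw [shiftOp]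
    fin_cases j <;> simp [hcoin, coeff_phase_mul, sub_eq_add_neg]

lemma tendsto_coeff_exp_freq {c : ℝ} (h1 : -1 < c) (h2 : c < 1) {f : ℝ → ℂ}
    (hf : IntervalIntegrable f volume (-Real.pi) Real.pi) (n : ℤ) :
    Tendsto (fun r : ℝ => coeff (fun k => cexp (r * freq c k * I) * f k) n)
      (cocompact ℝ) (𝓝 0) := by
  have h := (tendsto_integral_exp_freq_symm h1 h2
    (hf.continuousOn_mul (continuous_phase n).continuousOn)).const_mul
      (((2 * Real.pi)⁻¹ : ℝ) : ℂ)
  rw [mul_zero] at h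
  refine h.congr fun r => ?_
  rw [coeff]
  congr 2
  ext k
  ring

lemma pow_mulVec_of_eigenvector {n : Type*} [Fintype n] [DecidableEq n] {U : Matrix n n ℂ} {z : ℂ}
    {w : n → ℂ} (h : U *ᵥ w = z • w) (t : ℕ) : U ^ t *ᵥ w = z ^ t • w := by
  induction t with
  | zero => simp
  | succ t ih => rw [pow_succ, ← mulVec_mulVec, h, mulVec_smul, ih, smul_smul, pow_succ']

lemma tendsto_state {θ : ℝ} (h1 : -1 < Real.cos θ) (h2 : Real.cos θ < 1) (α β γ : ℂ) (x : ℤ)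
    (j : Fin 3) :
    Tendsto (fun t : ℕ => state θ α β γ t x j) atTop
      (𝓝 (coeff (fun k => stationaryPart θ ![α, β, γ] k j) x)) := by
  set v : Fin 3 → ℂ := ![α, β, γ] with hv
  set ω : ℝ → ℝ := freq (Real.cos θ) with hω
  set w : ℝ → Fin 3 → ℂ := fun k => v - stationaryPart θ v k with hw
  set g : ℝ → Fin 3 → ℂ := fun k => conjugateVector (stepMatrix θ k) (ω k) (w k) with hg
  have hquad := stepMatrix_quadratic_sub_stationaryPart h1 h2 v
  have hpc := continuous_stationaryPart h1 h2 v
  have hwc : Continuous w := continuous_const.sub hpc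
  have hωc : Continuous ω := continuous_freq _
  have hpi : IntervalIntegrable (fun k => stationaryPart θ v k j) volume (-Real.pi) Real.pi :=
    ((continuous_apply j).comp hpc).intervalIntegrable _ _
  have hwi : IntervalIntegrable (fun k => w k j) volume (-Real.pi) Real.pi :=
    ((continuous_apply j).comp hwc).intervalIntegrable _ _
  have hgm : Measurable fun k => g k j := by
    have hnum : Continuous fun k => (stepMatrix θ k *ᵥ w k - (Real.cos (ω k) : ℂ) • w k) j := by
      have := (continuous_stepMatrix θ).matrix_mulVec hwc
      exact (continuous_apply j).comp (by fun_prop)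
    have hden : Continuous fun k => (Real.sin (ω k) : ℂ) := by fun_prop
    exact hden.measurable.inv.mul hnum.measurable
  have hgi : IntervalIntegrable (fun k => g k j) volume (-Real.pi) Real.pi := by
    have hb : Continuous fun k => √(∑ i, ‖w k i‖ ^ 2) := by fun_prop
    refine (hb.intervalIntegrable _ _).mono_fun hgm.aestronglyMeasurable
      (Eventually.of_forall fun k => ?_)
    exact (norm_conjugateVector_le (stepMatrix_conjTranspose_mul θ k) (hquad k) j).trans
      (Real.le_norm_self _)
  have hminus : IntervalIntegrable (fun k => (w k j - I * g k j) / 2) volume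
      (-Real.pi) Real.pi := (hwi.sub (hgi.const_mul I)).div_const 2
  have hplus : IntervalIntegrable (fun k => (w k j + I * g k j) / 2) volume
      (-Real.pi) Real.pi := (hwi.add (hgi.const_mul I)).div_const 2
  have hexp : ∀ (r : ℝ) {f : ℝ → ℂ}, IntervalIntegrable f volume (-Real.pi) Real.pi →
      IntervalIntegrable (fun k => cexp (r * ω k * I) * f k) volume (-Real.pi) Real.pi :=
    fun r f hf => hf.continuousOn_mul (Continuous.continuousOn (by fun_prop))
  have hstate : ∀ t : ℕ, state θ α β γ t x j = coeff (fun k => stationaryPart θ v k j) x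
      + (coeff (fun k => cexp ((t : ℝ) * ω k * I) * ((w k j - I * g k j) / 2)) x
        + coeff (fun k => cexp ((-t : ℝ) * ω k * I) * ((w k j + I * g k j) / 2)) x) := fun t => by
    rw [← coeff_add (hexp t hminus) (by simpa using hexp (-t) hplus),
      ← coeff_add hpi ((hexp t hminus).add (by simpa using hexp (-t) hplus)), state_eq_coeff, ← hv]
    congr 1
    ext k
    have hU := stepMatrix_conjTranspose_mul θ k
    have hp := pow_mulVec_of_eigenvector (z := 1)
      (by rw [one_smul]; exact stepMatrix_mulVec_stationaryPart h2 v k) t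
    have hm : stepMatrix θ k ^ t *ᵥ (w k - I • g k) = cexp (ω k * I) ^ t • (w k - I • g k) :=
      pow_mulVec_of_eigenvector (mulVec_sub_I_smul hU (hquad k)) t
    have hq : stepMatrix θ k ^ t *ᵥ (w k + I • g k) = cexp (-ω k * I) ^ t • (w k + I • g k) :=
      pow_mulVec_of_eigenvector (mulVec_add_I_smul hU (hquad k)) t
    have hdec : v = stationaryPart θ v k + ((1 / 2 : ℂ) • (w k - I • g k)
        + (1 / 2 : ℂ) • (w k + I • g k)) := by
      ext i
      simp only [hw, Pi.add_apply, Pi.smul_apply, Pi.sub_apply, smul_eq_mul]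
      ring
    conv_lhs => rw [hdec]
    rw [mulVec_add, mulVec_add, mulVec_smul, mulVec_smul, hp, hm, hq, ← Complex.exp_nat_mul,
      ← Complex.exp_nat_mul]
    simp only [Pi.add_apply, Pi.smul_apply, smul_eq_mul, one_pow, one_mul, Pi.sub_apply]
    push_cast
    ring_nf
  have ht : Tendsto (fun t : ℕ => (t : ℝ)) atTop (cocompact ℝ) :=
    tendsto_natCast_atTop_atTop.mono_right atTop_le_cocompact
  have ht' : Tendsto (fun t : ℕ => (-t : ℝ)) atTop (cocompact ℝ) :=
    (tendsto_neg_atTop_atBot.comp tendsto_natCast_atTop_atTop).mono_right atBot_le_cocompact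
  have hlim := ((tendsto_coeff_exp_freq h1 h2 hminus x).comp ht).add
    ((tendsto_coeff_exp_freq h1 h2 hplus x).comp ht')
  rw [add_zero] at hlim
  have hfin := hlim.const_add (coeff (fun k => stationaryPart θ v k j) x)
  rw [add_zero] at hfin
  refine hfin.congr fun t => ?_
  rw [hstate]
  simp only [Function.comp_apply]
  push_cast
  rfl

/-! ### The limit amplitudes -/

/-- Up to a constant factor, the amplitude of the stationary state at `x` in the coin state `0`. -/
noncomputable def stationaryAmplitude (ν : ℝ) (A B : ℂ) (x : ℤ) : ℂ :=
  B * (ν : ℂ) ^ (x + 1).natAbs + A * (ν : ℂ) ^ x.natAbs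

lemma coeff_stationaryPart {θ : ℝ} (h1 : -1 < Real.cos θ) (h2 : Real.cos θ < 1) (α β γ : ℂ)
    {A B : ℂ}
    (hA : A = 2 * (1 - (Real.cos θ : ℂ)) * α + (√2 : ℝ) * (Real.sin θ : ℂ) * β)
    (hB : B = (√2 : ℝ) * (Real.sin θ : ℂ) * β + 2 * (1 - (Real.cos θ : ℂ)) * γ) (x : ℤ) :
    (fun j => coeff (fun k => stationaryPart θ ![α, β, γ] k j) x)
      = ((4 * √(2 * (1 - Real.cos θ)) : ℝ) : ℂ)⁻¹ •
        ![stationaryAmplitude (decayRate (Real.cos θ)) A B x,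
          (Real.sin θ : ℂ) / (√2 : ℝ) / (1 - Real.cos θ) *
            (stationaryAmplitude (decayRate (Real.cos θ)) A B x
              + stationaryAmplitude (decayRate (Real.cos θ)) A B (x - 1)),
          stationaryAmplitude (decayRate (Real.cos θ)) A B (x - 1)] := by
  have hc := continuous_resolvent h1 h2
  have hp := continuous_phase 1
  have hm := continuous_phase (-1)
  have ho := continuous_overlap θ ![α, β, γ]
  have hi : ∀ {f : ℝ → ℂ}, Continuous f → IntervalIntegrable f volume (-Real.pi) Real.pi :=
    fun hf => hf.intervalIntegrable _ _
  have hover : ∀ k, overlap θ ![α, β, γ] k = A / 2 + phase 1 k * (B / 2) := fun k => by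
    have h : (√2 : ℝ) * (Real.sin θ : ℂ) = 2 * ((Real.sin θ : ℂ) / (√2 : ℝ)) := by
      have h2 := ofReal_sqrt_two_sq
      have h0 := ofReal_sqrt_two_ne_zero
      field_simp
      rw [h2, mul_comm]
    rw [overlap, hA, hB, h]
    simp only [cons_val_zero, cons_val_one, cons_val]
    ring
  set a : ℤ → ℂ := coeff (fun k => resolvent (Real.cos θ) k * overlap θ ![α, β, γ] k) with ha
  have hamp : ∀ y, a y = ((4 * √(2 * (1 - Real.cos θ)) : ℝ) : ℂ)⁻¹ *
      stationaryAmplitude (decayRate (Real.cos θ)) A B y := fun y => by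
    have hrw : (fun k => resolvent (Real.cos θ) k * overlap θ ![α, β, γ] k)
        = fun k => A / 2 * resolvent (Real.cos θ) k
          + B / 2 * (phase 1 k * resolvent (Real.cos θ) k) := by
      ext k
      rw [hover]
      ring
    rw [ha, hrw, coeff_add (hi (by fun_prop)) (hi (by fun_prop)), coeff_const_mul,
      coeff_const_mul, coeff_phase_mul, coeff_resolvent h1 h2, coeff_resolvent h1 h2,
      stationaryAmplitude]
    push_cast [mul_inv]
    ring
  have hshift : coeff (fun k => phase (-1) k *
      (resolvent (Real.cos θ) k * overlap θ ![α, β, γ] k)) x = a (x - 1) :=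
    coeff_phase_mul (-1) _ x
  ext j
  fin_cases j
  · simpa [stationaryPart, stationaryVector] using hamp x
  · have hrw : (fun k => stationaryPart θ ![α, β, γ] k 1) = fun k =>
        (Real.sin θ : ℂ) / (√2 : ℝ) / (1 - Real.cos θ) *
          (resolvent (Real.cos θ) k * overlap θ ![α, β, γ] k
            + phase (-1) k * (resolvent (Real.cos θ) k * overlap θ ![α, β, γ] k)) := by
      ext k
      simp only [stationaryPart, stationaryVector, Pi.smul_apply, smul_eq_mul, cons_val_one,
        cons_val_zero]
      ring
    change coeff (fun k => stationaryPart θ ![α, β, γ] k 1) x = _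
    rw [hrw, coeff_const_mul, coeff_add (hi (by fun_prop)) (hi (by fun_prop)), hshift, ← ha,
      hamp, hamp]
    simp only [Fin.mk_one, Pi.smul_apply, smul_eq_mul, cons_val_one, cons_val_zero]
    ring
  · have hrw : (fun k => stationaryPart θ ![α, β, γ] k 2) = fun k =>
        phase (-1) k * (resolvent (Real.cos θ) k * overlap θ ![α, β, γ] k) := by
      ext k
      simp only [stationaryPart, stationaryVector, Pi.smul_apply, smul_eq_mul, cons_val]
      ring
    change coeff (fun k => stationaryPart θ ![α, β, γ] k 2) x = _
    rw [hrw, hshift, hamp]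
    rfl

lemma norm_stationaryAmplitude_le {ν : ℝ} (h0 : ν ≠ 0) (h1 : |ν| ≤ 1) (A B : ℂ) {x y : ℤ}
    (hxy : y = x ∨ y = x - 1) :
    ‖stationaryAmplitude ν A B y‖ ≤ (‖A‖ + ‖B‖) * |ν|⁻¹ * |ν| ^ x.natAbs := by
  have hpos : 0 < |ν| := abs_pos.2 h0
  have hpow : ∀ m : ℕ, x.natAbs ≤ m + 1 → |ν| ^ m ≤ |ν|⁻¹ * |ν| ^ x.natAbs := fun m hm => by
    rw [le_inv_mul_iff₀ hpos, ← pow_succ']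
    exact pow_le_pow_of_le_one hpos.le h1 hm
  have hB := mul_le_mul_of_nonneg_left (hpow (y + 1).natAbs (by omega)) (norm_nonneg B)
  have hA := mul_le_mul_of_nonneg_left (hpow y.natAbs (by omega)) (norm_nonneg A)
  refine (norm_add_le _ _).trans ?_
  rw [norm_mul, norm_mul, norm_pow, norm_pow, Complex.norm_real, Real.norm_eq_abs]
  linarith

lemma cos_mem_Ioo {θ : ℝ} (hθ : θ ∈ Set.Ico 0 (2 * Real.pi)) (hθ0 : θ ≠ 0) (hθπ : θ ≠ Real.pi) :
    Real.cos θ ∈ Set.Ioo (-1 : ℝ) 1 := by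
  have hs : Real.sin θ ≠ 0 := by
    rw [Ne, Real.sin_eq_zero_iff]
    rintro ⟨n, rfl⟩
    have hpi := Real.pi_pos
    have h0 : 0 ≤ n := by
      have := nonneg_of_mul_nonneg_left hθ.1 hpi
      exact_mod_cast this
    have h2 : n < 2 := by
      have := lt_of_mul_lt_mul_right hθ.2 hpi.le
      exact_mod_cast this
    interval_cases n <;> simp at hθ0 hθπ
  have h : Real.cos θ ^ 2 < 1 := by
    have := Real.sin_sq_add_cos_sq θ
    have := sq_pos_of_ne_zero hs
    linarith
  rwa [sq_lt_one_iff_abs_lt_one, abs_lt] at h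

end ThreeStateWalk

open ThreeStateWalk in
theorem theorem1 (θ : ℝ) (hθ : θ ∈ Set.Ico 0 (2 * Real.pi)) (hθ0 : θ ≠ 0) (hθπ : θ ≠ Real.pi)
    (α β γ : ℂ) (hnorm : ‖α‖ ^ 2 + ‖β‖ ^ 2 + ‖γ‖ ^ 2 = 1)
    (c s ν : ℝ) (hc : c = Real.cos θ) (hs : s = Real.sin θ)
    (hν : ν = (-(3 - c) + 2 * √(2 * (1 - c))) / (1 + c))
    (A B : ℂ) (hA : A = 2 * (1 - (c : ℂ)) * α + (√2 : ℝ) * (s : ℂ) * β)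
    (hB : B = (√2 : ℝ) * (s : ℂ) * β + 2 * (1 - (c : ℂ)) * γ) :
    ν ∈ Set.Ioo (-1 : ℝ) 0 ∧
    ∃ μ : ℤ → ℝ,
      (∀ x : ℤ, Tendsto (fun t : ℕ => ThreeStateWalk.prob θ α β γ t x) atTop (𝓝 (μ x))) ∧
      (∀ x : ℤ, μ x = 1 / (64 * (1 - c) ^ 2) *
        (2 * (1 - c) * ‖B * (ν : ℂ) ^ (x + 1).natAbs + A * (ν : ℂ) ^ x.natAbs‖ ^ 2
          + (1 + c) * ‖B * (ν : ℂ) ^ (x + 1).natAbs + (A + B) * (ν : ℂ) ^ x.natAbs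
              + A * (ν : ℂ) ^ (x - 1).natAbs‖ ^ 2
          + 2 * (1 - c) * ‖B * (ν : ℂ) ^ x.natAbs + A * (ν : ℂ) ^ (x - 1).natAbs‖ ^ 2)) ∧
      ∃ K : ℝ, ∀ x : ℤ, μ x ≤ K * |ν| ^ (2 * x.natAbs) := by
  obtain ⟨h1, h2⟩ := cos_mem_Ioo hθ hθ0 hθπ
  have hνd : ν = decayRate (Real.cos θ) := by rw [hν, hc, decayRate]
  have hmem : ν ∈ Set.Ioo (-1 : ℝ) 0 := hνd ▸ decayRate_mem h1 h2
  set a : ℤ → ℂ := stationaryAmplitude ν A B with ha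
  have hc1 : 0 < 1 - c := by rw [hc]; linarith
  have hc2 : 0 < 1 + c := by rw [hc]; linarith
  have hsum : ∀ x : ℤ, B * (ν : ℂ) ^ (x + 1).natAbs + (A + B) * (ν : ℂ) ^ x.natAbs
      + A * (ν : ℂ) ^ (x - 1).natAbs = a x + a (x - 1) := fun x => by
    simp only [ha, stationaryAmplitude, sub_add_cancel]
    ring
  have hpred : ∀ x : ℤ, B * (ν : ℂ) ^ x.natAbs + A * (ν : ℂ) ^ (x - 1).natAbs = a (x - 1) :=
    fun x => by simp only [ha, stationaryAmplitude, sub_add_cancel]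
  refine ⟨hmem, fun x => 1 / (64 * (1 - c) ^ 2) * (2 * (1 - c) * ‖a x‖ ^ 2
    + (1 + c) * ‖a x + a (x - 1)‖ ^ 2 + 2 * (1 - c) * ‖a (x - 1)‖ ^ 2), fun x => ?_,
    fun x => by rw [hsum, hpred]; rfl, 1 / (64 * (1 - c) ^ 2) * (2 * (1 - c) + (1 + c) * 4
      + 2 * (1 - c)) * ((‖A‖ + ‖B‖) * |ν|⁻¹) ^ 2, fun x => ?_⟩
  · have hlim := tendsto_finsetSum Finset.univ fun j (_ : j ∈ Finset.univ) =>
      ((tendsto_state h1 h2 α β γ x j).norm.pow 2)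
    rw [hc, hs] at hA hB
    have hcoeff := fun j => congrFun (coeff_stationaryPart h1 h2 α β γ hA hB x) j
    beta_reduce at hcoeff
    rw [← hνd, ← ha] at hcoeff
    -- `prob` unfolds to the sum of squared norms
    convert (show Tendsto (fun t => prob θ α β γ t x) atTop _ from hlim) using 2
    beta_reduce
    simp only [hcoeff, Fin.sum_univ_three]
    simp only [Pi.smul_apply, smul_eq_mul, Matrix.cons_val_zero, Matrix.cons_val_one,
      Matrix.cons_val, norm_mul, mul_pow]
    rw [← hc, ← hs]
    have hk : ‖((4 * √(2 * (1 - c)) : ℝ) : ℂ)⁻¹‖ ^ 2 = (32 * (1 - c))⁻¹ := by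
      rw [norm_inv, Complex.norm_real, inv_pow, Real.norm_eq_abs, sq_abs, mul_pow,
        Real.sq_sqrt (by linarith)]
      ring
    have hσ : ‖(s : ℂ) / (√2 : ℝ) / (1 - c)‖ ^ 2 = (1 + c) / (2 * (1 - c)) := by
      have hr : ‖(s : ℂ) / (√2 : ℝ) / (1 - c)‖ = |s / √2 / (1 - c)| := by
        rw [← Real.norm_eq_abs, ← Complex.norm_real]
        push_cast
        rfl
      rw [hr, sq_abs, div_pow, div_pow, Real.sq_sqrt zero_le_two, hs, Real.sin_sq, ← hc]
      field_simp
      ring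
    rw [hk, hσ]
    field_simp
    ring
  · have habs : |ν| ≤ 1 := abs_le.2 ⟨hmem.1.le, by linarith [hmem.2]⟩
    have hx := norm_stationaryAmplitude_le hmem.2.ne habs A B (Or.inl (rfl : x = x))
    have hy := norm_stationaryAmplitude_le hmem.2.ne habs A B (x := x) (Or.inr rfl)
    rw [← ha] at hx hy
    set D := (‖A‖ + ‖B‖) * |ν|⁻¹ * |ν| ^ x.natAbs with hD
    have hxy : ‖a x + a (x - 1)‖ ≤ 2 * D := (norm_add_le _ _).trans (by linarith)
    have hbound : 2 * (1 - c) * ‖a x‖ ^ 2 + (1 + c) * ‖a x + a (x - 1)‖ ^ 2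
        + 2 * (1 - c) * ‖a (x - 1)‖ ^ 2
        ≤ 2 * (1 - c) * D ^ 2 + (1 + c) * (2 * D) ^ 2 + 2 * (1 - c) * D ^ 2 := by
      gcongr
    refine (mul_le_mul_of_nonneg_left hbound (by positivity)).trans_eq ?_
    rw [hD, pow_mul']
    ring
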